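/- Let $M$ be a smooth (Hausdorff) manifold of dimension $n$ and let $\mathcal P$ be a pseudogroup of smooth local diffeomorphisms of $M$. Let $\mathrm{Diff}_k(M)$ be the set of linear scalar differential operators of order $\le k$ on $M$ with smooth coefficients, and let $J^l(\psi_k)$ be the manifold of $l$-jets $[A]^l_x$ of such operators (regarded as sections of the bundle $\psi_k$ of operators of order $\le k$). For a function $F$ on $J^l(\psi_k)$ write $F(A)$ for the function $x\mapsto F([A]^l_x)$ on $M$; the total differential $\widehat dF$ at $[A]^{l+1}_x$ is the differential of $F(A)$ at $x$. Let $I_1,\dots,I_n$ be $\mathcal P$-invariants of order $\le l$, i.e. functions on $J^l(\psi_k)$ that are smooth on an open set $\mathcal D\subset J^l(\psi_k)$ and satisfy $I_i(\varphi^{(l)}\theta)=I_i(\theta)$ whenever $\varphi\in\mathcal P$ and $\theta,\varphi^{(l)}\theta\in\mathcal D$, where $\varphi^{(l)}$ is the prolongation of $\varphi$ (for example, rational $\mathcal P$-invariants that are regular on $\mathcal D$). Let $\mathcal O\subset J^{l+1}(\psi_k)$ be an open set that projects into $\mathcal D$, on which the $I_i$ are in general position: $\widehat dI_1\wedge\dots\wedge\widehat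 dI_n\ne0$ at all points of $\mathcal O$. For $A\in\mathrm{Diff}_k(M)$ and $U\subset M$, call the pair $(A,U)$ adjusted if $[A]^{l+1}_x\in\mathcal O$ for all $x\in U$ and the functions $I_1(A),\dots,I_n(A)$ are coordinates on $U$, i.e. they are the components of a smooth chart of $M$ with domain $U$. For a multi-index $\alpha$ with $|\alpha|\le k$ put $I_\alpha(A)=\frac1{\alpha!}A\bigl(I_1(A)^{\alpha_1}\cdots I_n(A)^{\alpha_n}\bigr)$ and $$\phi_A(x)=\bigl(I_1(A)(x),\dots,I_n(A)(x),\,(I_\alpha(A)(x))_{|\alpha|\le k}\bigr)\in\mathbb R^n\times\mathbb R^{\binom{n+k}{k}}.$$ The image $\phi_A(U)$ is the $\mathcal P$-model of $A$ in $U$. Theorem ($n$-invariants principle). Let $(A,\mathcal O')$ and $(B,\mathcal O'')$ be adjusted pairs for the same $I_1,\dots,I_n$. If $\phi_A(\mathcal O')=\phi_B(\mathcal O'')$, then there is a unique diffeomorphism $\psi_{AB}:\mathcal O'\to\mathcal O''$ with $\psi_{AB}^*(I_i(B))=I_i(A)$ for $i=1,\dots,n$. Moreover, $A$ and $B$ are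 $\mathcal P$-equivalent in $\mathcal O'$ and $\mathcal O''$, i.e. there is a diffeomorphism $\varphi:\mathcal O'\to\mathcal O''$ in $\mathcal P$ with $\varphi_*(A|_{\mathcal O'})=B|_{\mathcal O''}$, if and only if $\phi_A(\mathcal O')=\phi_B(\mathcal O'')$ and $\psi_{AB}\in\mathcal P$. -/

import Mathlib

open Set Filter Topology
open scoped Manifold ContDiff

noncomputable section

namespace NInv

/-- The model space `ℝⁿ`. -/
abbrev E (n : ℕ) : Type := EuclideanSpace ℝ (Fin n)

/-- The finite set of multi-indices `α = (α₁, …, αₙ)` with `|α| = α₁ + ⋯ + αₙ ≤ k`. -/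
def multiIdx (n k : ℕ) : Finset (Fin n → ℕ) :=
  (Fintype.piFinset fun _ : Fin n => Finset.range (k + 1)).filter fun α => ∑ i, α i ≤ k

theorem mem_multiIdx {n k : ℕ} {α : Fin n → ℕ} : α ∈ multiIdx n k ↔ ∑ i, α i ≤ k := by
  simp only [multiIdx, Finset.mem_filter, Fintype.mem_piFinset, Finset.mem_range,
    and_iff_right_iff_imp]
  intro h i
  exact Nat.lt_succ_of_le
    ((Finset.single_le_sum (fun j _ => Nat.zero_le (α j)) (Finset.mem_univ i)).trans h)

/-- `α! = α₁! ⋯ αₙ!`. -/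
def multiFactorial {n : ℕ} (α : Fin n → ℕ) : ℕ := ∏ i, (α i).factorial

/-- The monomial `v^α = v₁^{α₁} ⋯ vₙ^{αₙ}`. -/
def monom {n : ℕ} (α : Fin n → ℕ) (v : Fin n → ℝ) : ℝ := ∏ i, v i ^ α i

/-- The partial derivative `∂g/∂xᵢ` of a function on `ℝⁿ`. -/
def pderiv {n : ℕ} (i : Fin n) (g : E n → ℝ) (y : E n) : ℝ :=
  fderiv ℝ g y (EuclideanSpace.single i 1)

/-- The iterated partial derivative `∂^α = ∂₁^{α₁} ⋯ ∂ₙ^{αₙ}`. -/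
def multiDeriv {n : ℕ} (α : Fin n → ℕ) (g : E n → ℝ) : E n → ℝ :=
  (List.finRange n).foldr (fun i h => (pderiv i)^[α i] h) g

section Operators

variable {n : ℕ} {M : Type*} [TopologicalSpace M] [ChartedSpace (E n) M]

/-- `f` is a smooth function near the point `x` of the manifold `M`. -/
abbrev SmoothAt (n : ℕ) {M : Type*} [TopologicalSpace M] [ChartedSpace (E n) M]
    (f : M → ℝ) (x : M) : Prop :=
  ContMDiffAt (𝓡 n) 𝓘(ℝ, ℝ) ∞ f x

/-- The coefficient `A_α` of an operator `A` in a chart `e`, as a function on the target of `e`: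
at the point with coordinates `y` it is the value there of `A` on the function
`(x - y)^α / α!`, where `x` are the coordinates of the chart. -/
def opCoeff (A : (M → ℝ) → M → ℝ) (e : OpenPartialHomeomorph M (E n)) (α : Fin n → ℕ)
    (y : E n) : ℝ :=
  (multiFactorial α : ℝ)⁻¹ * A (fun z => monom α fun i => e z i - y i) (e.symm y)

/-- Linear scalar differential operators of order `≤ k` on `M`. Such an operator acts on all
locally defined smooth functions: `A f x` is its value at `x` on a function that is smooth near
`x`. In every chart it is `∑_{|α| ≤ k} A_α ∂^α` with smooth coefficients `A_α`. The last field
only fixes the irrelevant value on functions that are not smooth at the point. -/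
structure DiffOp (n k : ℕ) (M : Type*) [TopologicalSpace M] [ChartedSpace (E n) M] where
  toFun : (M → ℝ) → M → ℝ
  contDiffOn_coeff : ∀ e ∈ IsManifold.maximalAtlas (𝓡 n) ∞ M, ∀ α ∈ multiIdx n k,
    ContDiffOn ℝ ∞ (opCoeff toFun e α) e.target
  local_form : ∀ e ∈ IsManifold.maximalAtlas (𝓡 n) ∞ M, ∀ x ∈ e.source, ∀ f : M → ℝ,
    SmoothAt n f x →
      toFun f x = ∑ α ∈ multiIdx n k, opCoeff toFun e α (e x) * multiDeriv α (f ∘ e.symm) (e x)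
  eq_zero_of_not_smoothAt : ∀ (f : M → ℝ) (x : M), ¬ SmoothAt n f x → toFun f x = 0

instance (k : ℕ) : CoeFun (DiffOp n k M) fun _ => (M → ℝ) → M → ℝ := ⟨DiffOp.toFun⟩

/-- `φ_* A = B` at `φ x`, where `φ_* A = (φ⁻¹)^* ∘ A ∘ φ^*`. -/
def PushesAt {k : ℕ} (φ : OpenPartialHomeomorph M M) (A B : DiffOp n k M) (x : M) : Prop :=
  ∀ f : M → ℝ, SmoothAt n f (φ x) → A (f ∘ φ) x = B f (φ x)

/-- The operators `A` on `U` and `B` on `V` are equivalent with respect to the pseudogroup `P`: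
some diffeomorphism `φ : U → V` belonging to `P` takes `A|_U` to `B|_V`. -/
def PEquivalent {k : ℕ} (P : StructureGroupoid M) (A : DiffOp n k M) (U : Set M)
    (B : DiffOp n k M) (V : Set M) : Prop :=
  ∃ φ ∈ P, φ.source = U ∧ φ.target = V ∧ ∀ x ∈ U, PushesAt φ A B x

/-! ### Jets of differential operators -/

/-- The coordinates `(x_i, u_α^σ)`, `|σ| ≤ l`, `|α| ≤ k`, of the `l`-jet of (the section
corresponding to) `A` at `x`, in the chart `e`: the coordinates of `x` and the derivatives
`∂^σ A_α`. -/
def jetCoord {k : ℕ} (l : ℕ) (e : OpenPartialHomeomorph M (E n)) (A : DiffOp n k M) (x : M) :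
    E n × (multiIdx n l → multiIdx n k → ℝ) :=
  (e x, fun σ α => multiDeriv σ.1 (opCoeff A e α.1) (e x))

/-- Two operators have the same `l`-jet at a point if the derivatives of their coefficients up to
order `l` agree there, in the charts around the point. -/
def jetSetoid (n k l : ℕ) (M : Type*) [TopologicalSpace M] [ChartedSpace (E n) M] :
    Setoid (DiffOp n k M × M) where
  r p q := p.2 = q.2 ∧ ∀ e ∈ IsManifold.maximalAtlas (𝓡 n) ∞ M, p.2 ∈ e.source →
    jetCoord l e p.1 p.2 = jetCoord l e q.1 q.2
  iseqv :=
    { refl := fun _ => ⟨rfl, fun _ _ _ => rfl⟩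
      symm := fun h => ⟨h.1.symm, fun e he hx => (h.2 e he (h.1 ▸ hx)).symm⟩
      trans := fun h h' => ⟨h.1.trans h'.1, fun e he hx =>
        (h.2 e he hx).trans (h'.2 e he (h.1 ▸ hx))⟩ }

/-- The space `J^l(ψ_k)` of `l`-jets of linear differential operators of order `≤ k` on `M`. -/
def Jet (n k l : ℕ) (M : Type*) [TopologicalSpace M] [ChartedSpace (E n) M] : Type _ :=
  Quotient (jetSetoid n k l M)

/-- The `l`-jet `[A]_x^l`. -/
def jet {k : ℕ} (l : ℕ) (A : DiffOp n k M) (x : M) : Jet n k l M :=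
  Quotient.mk (jetSetoid n k l M) (A, x)

/-- The projection `J^{l+1}(ψ_k) → J^l(ψ_k)`. -/
def jetProj {k l : ℕ} : Jet n k (l + 1) M → Jet n k l M :=
  Quotient.map id fun p q h => ⟨h.1, fun e he hx => by
    have h1 := h.2 e he hx
    refine Prod.ext (show e p.2 = e q.2 from congrArg e h.1) (funext fun σ => ?_)
    exact congrFun (congrArg Prod.snd h1)
      ⟨σ.1, mem_multiIdx.2 ((mem_multiIdx.1 σ.2).trans (Nat.le_succ l))⟩⟩

/-- The image of a set of jets in the coordinates induced by a chart of `M`. -/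
def jetImage {k l : ℕ} (W : Set (Jet n k l M)) (e : OpenPartialHomeomorph M (E n)) :
    Set (E n × (multiIdx n l → multiIdx n k → ℝ)) :=
  {p | ∃ (A : DiffOp n k M) (x : M), x ∈ e.source ∧ jet l A x ∈ W ∧ jetCoord l e A x = p}

/-- Open subsets of the manifold `J^l(ψ_k)`. -/
def IsOpenJet {k l : ℕ} (W : Set (Jet n k l M)) : Prop :=
  ∀ e ∈ IsManifold.maximalAtlas (𝓡 n) ∞ M, IsOpen (jetImage W e)

/-- Functions on `J^l(ψ_k)` that are smooth on a set of jets: smooth functions of the jet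
coordinates. -/
def SmoothOnJet {k l : ℕ} (F : Jet n k l M → ℝ) (W : Set (Jet n k l M)) : Prop :=
  ∀ e ∈ IsManifold.maximalAtlas (𝓡 n) ∞ M,
    ∃ G : E n × (multiIdx n l → multiIdx n k → ℝ) → ℝ, ContDiffOn ℝ ∞ G (jetImage W e) ∧
      ∀ (A : DiffOp n k M) (x : M), x ∈ e.source → jet l A x ∈ W →
        F (jet l A x) = G (jetCoord l e A x)

/-- The prolonged action of a local diffeomorphism `φ` on `l`-jets: `θ' = φ^{(l)} θ` means that
`θ = [A]_x^l` and `θ' = [B]_{φ x}^l` for operators with `φ_* A = B` near `φ x`. -/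
def JetMapsTo {k l : ℕ} (φ : OpenPartialHomeomorph M M) (θ θ' : Jet n k l M) : Prop :=
  ∃ (A B : DiffOp n k M) (x : M), x ∈ φ.source ∧ θ = jet l A x ∧ θ' = jet l B (φ x) ∧
    ∀ᶠ y in 𝓝 x, PushesAt φ A B y

/-- `F`, considered on the set `D` of jets, is invariant under the prolonged action of `P`. -/
def IsPInvariantOn {k l : ℕ} (P : StructureGroupoid M) (F : Jet n k l M → ℝ)
    (D : Set (Jet n k l M)) : Prop :=
  ∀ φ ∈ P, ∀ θ ∈ D, ∀ θ' ∈ D, JetMapsTo φ θ θ' → F θ' = F θ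

/-- The value `F(A)` of a function on jets at an operator `A`: the function `x ↦ F([A]_x^l)`. -/
def value {k l : ℕ} (F : Jet n k l M → ℝ) (A : DiffOp n k M) (x : M) : ℝ := F (jet l A x)

/-- The total differential of `F` at the jet `[A]_x^{l+1}`: the differential of `F(A)` at `x`. -/
def totalDiff {k l : ℕ} (F : Jet n k l M → ℝ) (A : DiffOp n k M) (x : M) :
    TangentSpace (𝓡 n) x →L[ℝ] ℝ :=
  mfderiv (𝓡 n) 𝓘(ℝ, ℝ) (value F A) x

/-- `I₁, …, Iₙ` are in general position over a set `O` of `(l+1)`-jets: the total differentials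
are linearly independent, i.e. their exterior product does not vanish, at all jets in `O`. -/
def InGeneralPosition {k l : ℕ} (I : Fin n → Jet n k l M → ℝ) (O : Set (Jet n k (l + 1) M)) :
    Prop :=
  ∀ (A : DiffOp n k M) (x : M), jet (l + 1) A x ∈ O →
    LinearIndependent ℝ fun i => totalDiff (I i) A x

/-- The value `I_α(A)` of the invariant `I_α = (1/α!) □(I^α)`, where `□` is the universal
differential operator, `□(F)(A) = A(F(A))`. -/
def valueAlpha {k l : ℕ} (I : Fin n → Jet n k l M → ℝ) (α : Fin n → ℕ) (A : DiffOp n k M)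
    (x : M) : ℝ :=
  (multiFactorial α : ℝ)⁻¹ * A (fun z => monom α fun i => value (I i) A z) x

/-- The map `φ_A : M → Φ_k = ℝⁿ × ℝ^{α : |α| ≤ k}`,
`x ↦ (I₁(A), …, Iₙ(A), (I_α(A))_{|α| ≤ k})`. -/
def modelMap {k l : ℕ} (I : Fin n → Jet n k l M → ℝ) (A : DiffOp n k M) (x : M) :
    (Fin n → ℝ) × (multiIdx n k → ℝ) :=
  (fun i => value (I i) A x, fun α => valueAlpha I α.1 A x)

/-- The model `φ_A(U)` of the operator `A` in the domain `U`. -/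
def model {k l : ℕ} (I : Fin n → Jet n k l M → ℝ) (A : DiffOp n k M) (U : Set M) :
    Set ((Fin n → ℝ) × (multiIdx n k → ℝ)) :=
  modelMap I A '' U

/-- The pair `(A, U)` is adjusted: the jets of `A` over `U` lie in `O`, and the functions
`I₁(A), …, Iₙ(A)` are coordinates in the domain `U`, i.e. they are the components of a chart of
`M` with domain `U`. -/
def Adjusted {k l : ℕ} (I : Fin n → Jet n k l M → ℝ) (O : Set (Jet n k (l + 1) M))
    (A : DiffOp n k M) (U : Set M) : Prop :=
  (∀ x ∈ U, jet (l + 1) A x ∈ O) ∧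
    ∃ e ∈ IsManifold.maximalAtlas (𝓡 n) ∞ M, e.source = U ∧
      ∀ x ∈ U, ∀ i, e x i = value (I i) A x

/-- `ψ : U → V` is a diffeomorphism that matches the coordinates `I_i(A)` and `I_i(B)`:
`ψ^*(I_i(B)) = I_i(A)`. -/
structure IsMatching {k l : ℕ} (I : Fin n → Jet n k l M → ℝ) (A : DiffOp n k M) (U : Set M)
    (B : DiffOp n k M) (V : Set M) (ψ : OpenPartialHomeomorph M M) : Prop where
  source_eq : ψ.source = U
  target_eq : ψ.target = V
  smooth : ContMDiffOn (𝓡 n) (𝓡 n) ∞ ψ U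
  smooth_symm : ContMDiffOn (𝓡 n) (𝓡 n) ∞ ψ.symm V
  value_eq : ∀ x ∈ U, ∀ i, value (I i) B (ψ x) = value (I i) A x

end Operators

end NInv

end

namespace NInv

/-! The invariants provide charts `eA` and `eB` with components `I_i(A)` and `I_i(B)`, and a
matching map must be `eB.symm ∘ eA`. The model is a graph over the common target of these charts,
and its fibre coordinates are the values of the operator on monomials of degree at most `k`, up to
the factor `1/α!`. These values determine the coefficients (`opCoeff_eq_of_apply_monom_eq`): the
coefficient at `y` is the value on `(x - y)^α / α!`, and this polynomial expands into monomials of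
degree at most `k`. Equal models thus mean equal local expressions of `A` in `eA` and of `B` in
`eB`, so the matching map carries `A` to `B`. Conversely, by invariance an equivalence matches the
coordinates, hence the monomials in them, hence the models. -/

theorem contDiff_monom {n : ℕ} (α : Fin n → ℕ) : ContDiff ℝ ∞ fun v : E n => monom α fun i => v i :=
  contDiff_prod fun i _ => by fun_prop

theorem multiFactorial_ne_zero {n : ℕ} (α : Fin n → ℕ) : (multiFactorial α : ℝ) ≠ 0 :=
  Nat.cast_ne_zero.2 (Finset.prod_ne_zero_iff.2 fun _ _ => Nat.factorial_ne_zero _)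

/-- A monomial in `v - c` is a linear combination of monomials in `v` of no larger degree. -/
theorem exists_monom_sub_eq_sum {n k : ℕ} (α : Fin n → ℕ) (hα : ∑ i, α i ≤ k) (c : Fin n → ℝ) :
    ∃ (S : Finset (Fin n →₀ ℕ)) (a : (Fin n →₀ ℕ) → ℝ), (∀ d ∈ S, ∑ i, d i ≤ k) ∧
      ∀ v : Fin n → ℝ, (monom α fun i => v i - c i) = ∑ d ∈ S, a d * monom d v := by
  let p : MvPolynomial (Fin n) ℝ := ∏ i, (MvPolynomial.X i - MvPolynomial.C (c i)) ^ α i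
  have hp : p.totalDegree ≤ k := by
    refine (MvPolynomial.totalDegree_finsetProd _ _).trans (le_trans ?_ hα)
    refine Finset.sum_le_sum fun i _ => (MvPolynomial.totalDegree_pow _ _).trans ?_
    have h : (MvPolynomial.X i - MvPolynomial.C (c i) : MvPolynomial (Fin n) ℝ).totalDegree ≤ 1 :=
      (MvPolynomial.totalDegree_sub _ _).trans (by simp)
    simpa using Nat.mul_le_mul_left (α i) h
  refine ⟨p.support, p.coeff, fun d hd => ?_, fun v => ?_⟩
  · have h := MvPolynomial.le_totalDegree hd
    rw [Finsupp.sum_fintype _ _ fun _ => rfl] at h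
    exact h.trans hp
  · have h := MvPolynomial.eval_eq' v p
    simpa [p, monom, map_prod] using h

/-! ### Iterated partial derivatives -/

theorem pderiv_congr {n : ℕ} (i : Fin n) {g h : E n → ℝ} {y : E n} (hgh : g =ᶠ[𝓝 y] h) :
    pderiv i g =ᶠ[𝓝 y] pderiv i h := by
  filter_upwards [hgh.eventuallyEq_nhds] with z hz
  rw [pderiv, pderiv, hz.fderiv_eq]

theorem contDiffAt_pderiv {n : ℕ} (i : Fin n) {g : E n → ℝ} {y : E n}
    (hg : ContDiffAt ℝ ∞ g y) : ContDiffAt ℝ ∞ (pderiv i g) y :=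
  (hg.fderiv_right (m := ∞) (by simp)).clm_apply contDiffAt_const

/-- Equality of germs, not just at `y`, is what lets the identity be differentiated again. -/
theorem pderiv_sum {n : ℕ} {ι : Type*} (i : Fin n) (S : Finset ι) (a : ι → ℝ) {g : ι → E n → ℝ}
    {y : E n} (hg : ∀ j ∈ S, ContDiffAt ℝ ∞ (g j) y) :
    pderiv i (fun z => ∑ j ∈ S, a j * g j z) =ᶠ[𝓝 y] fun z => ∑ j ∈ S, a j * pderiv i (g j) z := by
  have h : ∀ᶠ z in 𝓝 y, ∀ j ∈ S, DifferentiableAt ℝ (g j) z := by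
    refine (Filter.eventually_all_finset S).2 fun j hj => ?_
    -- `ContDiffAt` of order `∞` at a point need not persist on a neighbourhood; a finite order
    -- does.
    filter_upwards [((hg j hj).of_le (m := 1) (by norm_cast)).eventually (by simp)]
      with z hz
    exact hz.differentiableAt (by simp)
  filter_upwards [h] with z hz
  rw [pderiv, fderiv_fun_sum fun j hj => (hz j hj).const_mul (a j)]
  rw [sum_apply]
  refine Finset.sum_congr rfl fun j hj => ?_
  rw [fderiv_const_mul (hz j hj)]
  rfl

/-- Operators on functions that are local, preserve smoothness and are linear on smooth
functions, at the point `y`. -/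
structure IsLocalLinearAt {n : ℕ} (T : (E n → ℝ) → E n → ℝ) (y : E n) : Prop where
  congr : ∀ {g h : E n → ℝ}, g =ᶠ[𝓝 y] h → T g =ᶠ[𝓝 y] T h
  contDiffAt : ∀ {g : E n → ℝ}, ContDiffAt ℝ ∞ g y → ContDiffAt ℝ ∞ (T g) y
  map_sum : ∀ (S : Finset (Fin n →₀ ℕ)) (a : (Fin n →₀ ℕ) → ℝ) {g : (Fin n →₀ ℕ) → E n → ℝ},
    (∀ j ∈ S, ContDiffAt ℝ ∞ (g j) y) →
      T (fun z => ∑ j ∈ S, a j * g j z) =ᶠ[𝓝 y] fun z => ∑ j ∈ S, a j * T (g j) z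

theorem isLocalLinearAt_id {n : ℕ} (y : E n) : IsLocalLinearAt id y :=
  ⟨fun h => h, fun h => h, fun _ _ _ _ => EventuallyEq.rfl⟩

theorem isLocalLinearAt_pderiv {n : ℕ} (i : Fin n) (y : E n) : IsLocalLinearAt (pderiv i) y :=
  ⟨pderiv_congr i, contDiffAt_pderiv i, fun S a _ hg => pderiv_sum i S a hg⟩

theorem IsLocalLinearAt.comp {n : ℕ} {T T' : (E n → ℝ) → E n → ℝ} {y : E n}
    (hT : IsLocalLinearAt T y) (hT' : IsLocalLinearAt T' y) :
    IsLocalLinearAt (fun g => T (T' g)) y :=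
  ⟨fun h => hT.congr (hT'.congr h), fun h => hT.contDiffAt (hT'.contDiffAt h), fun S a _ hg =>
    (hT.congr (hT'.map_sum S a hg)).trans (hT.map_sum S a fun j hj => hT'.contDiffAt (hg j hj))⟩

theorem IsLocalLinearAt.iterate {n : ℕ} {T : (E n → ℝ) → E n → ℝ} {y : E n}
    (hT : IsLocalLinearAt T y) (m : ℕ) : IsLocalLinearAt (T^[m]) y := by
  induction m with
  | zero => exact isLocalLinearAt_id y
  | succ m ih =>
    rw [Function.iterate_succ]
    exact ih.comp hT

theorem isLocalLinearAt_multiDeriv {n : ℕ} (α : Fin n → ℕ) (y : E n) :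
    IsLocalLinearAt (multiDeriv α) y := by
  unfold multiDeriv
  induction List.finRange n with
  | nil => exact isLocalLinearAt_id y
  | cons i L ih => exact ((isLocalLinearAt_pderiv i y).iterate (α i)).comp ih

theorem comp_symm_eventuallyEq {n : ℕ} {M N : Type*} [TopologicalSpace M] {f g : M → N} {x : M} {e : OpenPartialHomeomorph M (E n)}
    (hx : x ∈ e.source) (h : f =ᶠ[𝓝 x] g) : f ∘ e.symm =ᶠ[𝓝 (e x)] g ∘ e.symm := by
  have ht := e.symm.continuousAt (e.map_source hx)
  rw [ContinuousAt, e.left_inv hx] at ht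
  exact ht.eventually h

/-! ### Locality, linearity and coefficients of differential operators -/

section Operators

variable {n k l : ℕ} {M : Type*} [TopologicalSpace M] [ChartedSpace (E n) M]

theorem smoothAt_congr {f g : M → ℝ} {x : M} (h : f =ᶠ[𝓝 x] g) : SmoothAt n f x ↔ SmoothAt n g x :=
  h.contMDiffAt_iff

theorem SmoothAt.contDiffAt_comp_symm {f : M → ℝ} {x : M} (hf : SmoothAt n f x)
    {e : OpenPartialHomeomorph M (E n)} (he : e ∈ IsManifold.maximalAtlas (𝓡 n) ∞ M)
    (hx : x ∈ e.source) : ContDiffAt ℝ ∞ (f ∘ e.symm) (e x) := by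
  have hs := contMDiffAt_symm_of_mem_maximalAtlas he (e.map_source hx)
  have hf' : ContMDiffAt (𝓡 n) 𝓘(ℝ, ℝ) ∞ f (e.symm (e x)) := by rwa [e.left_inv hx]
  exact contMDiffAt_iff_contDiffAt.1 (hf'.comp (e x) hs)

theorem smoothAt_comp_chart {g : E n → ℝ} (hg : ContDiff ℝ ∞ g)
    {e : OpenPartialHomeomorph M (E n)} (he : e ∈ IsManifold.maximalAtlas (𝓡 n) ∞ M) {x : M}
    (hx : x ∈ e.source) : SmoothAt n (fun z => g (e z)) x :=
  hg.contMDiff.contMDiffAt.comp x (contMDiffAt_of_mem_maximalAtlas he hx)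

/-- The invariants agree with the coordinates only on the chart domain; equality of germs suffices
because operators are local. -/
theorem eventuallyEq_monom_value {I : Fin n → Jet n k l M → ℝ} {A : DiffOp n k M}
    {e : OpenPartialHomeomorph M (E n)} (h : ∀ x ∈ e.source, ∀ i, e x i = value (I i) A x)
    (α : Fin n → ℕ) {x : M} (hx : x ∈ e.source) :
    (fun z => monom α fun i => value (I i) A z) =ᶠ[𝓝 x] fun z => monom α fun i => e z i := by
  filter_upwards [e.open_source.mem_nhds hx] with z hz
  simp only [h z hz]

variable [IsManifold (𝓡 n) ∞ M]

/-- Differential operators are local. -/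
theorem DiffOp.congr (A : DiffOp n k M) {f g : M → ℝ} {x : M} (h : f =ᶠ[𝓝 x] g) :
    A f x = A g x := by
  by_cases hf : SmoothAt n f x
  · have he := IsManifold.chart_mem_maximalAtlas (I := 𝓡 n) (n := ∞) x
    have hx := mem_chart_source (E n) x
    rw [A.local_form _ he x hx f hf, A.local_form _ he x hx g ((smoothAt_congr h).1 hf)]
    refine Finset.sum_congr rfl fun α _ => ?_
    rw [((isLocalLinearAt_multiDeriv α _).congr (comp_symm_eventuallyEq hx h)).eq_of_nhds]
  -- Smoothness depends only on the germ, so both sides take the default value zero.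
  · rw [A.eq_zero_of_not_smoothAt f x hf,
      A.eq_zero_of_not_smoothAt g x fun hg => hf ((smoothAt_congr h).2 hg)]

/-- Differential operators are linear. -/
theorem DiffOp.map_sum (A : DiffOp n k M) (S : Finset (Fin n →₀ ℕ)) (a : (Fin n →₀ ℕ) → ℝ)
    {f : (Fin n →₀ ℕ) → M → ℝ} {x : M} (hf : ∀ j, SmoothAt n (f j) x) :
    A (fun z => ∑ j ∈ S, a j * f j z) x = ∑ j ∈ S, a j * A (f j) x := by
  have he := IsManifold.chart_mem_maximalAtlas (I := 𝓡 n) (n := ∞) x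
  have hx := mem_chart_source (E n) x
  have hs : SmoothAt n (fun z => ∑ j ∈ S, a j * f j z) x :=
    ContMDiffAt.sum fun j _ => contMDiffAt_const.mul (hf j)
  rw [A.local_form _ he x hx _ hs]
  simp_rw [fun j => A.local_form _ he x hx (f j) (hf j), Finset.mul_sum]
  rw [Finset.sum_comm]
  refine Finset.sum_congr rfl fun α _ => ?_
  have h := ((isLocalLinearAt_multiDeriv α (chartAt (E n) x x)).map_sum S a fun j _ =>
    (hf j).contDiffAt_comp_symm he hx).eq_of_nhds
  rw [show (fun z => ∑ j ∈ S, a j * f j z) ∘ (chartAt (E n) x).symm =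
    fun z => ∑ j ∈ S, a j * (f j ∘ (chartAt (E n) x).symm) z from rfl, h, Finset.mul_sum]
  exact Finset.sum_congr rfl fun j _ => by ring

/-- The coefficients of an operator in a chart are determined by its values on the monomials in
the coordinates. -/
theorem opCoeff_eq_of_apply_monom_eq (A B : DiffOp n k M) {e e' : OpenPartialHomeomorph M (E n)}
    (he : e ∈ IsManifold.maximalAtlas (𝓡 n) ∞ M) (he' : e' ∈ IsManifold.maximalAtlas (𝓡 n) ∞ M)
    {x x' : M} (hx : x ∈ e.source) (hx' : x' ∈ e'.source) (hxx' : e x = e' x')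
    (h : ∀ α ∈ multiIdx n k, A (fun z => monom α fun i => e z i) x =
      B (fun z => monom α fun i => e' z i) x')
    {α : Fin n → ℕ} (hα : α ∈ multiIdx n k) : opCoeff A e α (e x) = opCoeff B e' α (e' x') := by
  obtain ⟨S, a, hS, hsum⟩ := exists_monom_sub_eq_sum α (mem_multiIdx.1 hα) fun i => e x i
  have hA : (fun z => monom α fun i => e z i - e x i) =
      fun z => ∑ d ∈ S, a d * monom d fun i => e z i := funext fun z => hsum _
  have hB : (fun z => monom α fun i => e' z i - e' x' i) =
      fun z => ∑ d ∈ S, a d * monom d fun i => e' z i := by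
    -- Both expansions have the same centre, hence the same `S` and `a`.
    rw [← hxx']
    exact funext fun z => hsum _
  rw [opCoeff, opCoeff, e.left_inv hx, e'.left_inv hx', hA, hB]
  rw [A.map_sum S a fun d => smoothAt_comp_chart (contDiff_monom d) he hx,
    B.map_sum S a fun d => smoothAt_comp_chart (contDiff_monom d) he' hx']
  congr 1
  exact Finset.sum_congr rfl fun d hd => by rw [h d (mem_multiIdx.2 (hS d hd))]

end Operators

end NInv

/-! ### The principle of `n` invariants -/

theorem mainTheorem1 {n k l : ℕ} {M : Type*} [TopologicalSpace M] [T2Space M]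
    [ChartedSpace (NInv.E n) M] [IsManifold (𝓡 n) ∞ M]
    -- a pseudogroup of smooth local diffeomorphisms of `M`
    (P : StructureGroupoid M) [ClosedUnderRestriction P]
    (hP : ∀ φ ∈ P, ContMDiffOn (𝓡 n) (𝓡 n) ∞ φ φ.source)
    -- invariants of order `≤ l`, smooth on `D`
    (I : Fin n → NInv.Jet n k l M → ℝ) (D : Set (NInv.Jet n k l M)) (hD : NInv.IsOpenJet D)
    (hsmooth : ∀ i, NInv.SmoothOnJet (I i) D)
    (hinv : ∀ i, NInv.IsPInvariantOn P (I i) D)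
    -- general position over an open set of jets
    (O : Set (NInv.Jet n k (l + 1) M)) (hO : NInv.IsOpenJet O) (hOD : O ⊆ NInv.jetProj ⁻¹' D)
    (hgen : NInv.InGeneralPosition I O)
    (A B : NInv.DiffOp n k M) (U V : Set M)
    (hA : NInv.Adjusted I O A U) (hB : NInv.Adjusted I O B V) :
    -- `ψ_AB` is well defined once the models coincide
    (NInv.model I A U = NInv.model I B V →
      ∃ ψ, NInv.IsMatching I A U B V ψ ∧
        ∀ ψ', NInv.IsMatching I A U B V ψ' → ψ'.source = ψ.source ∧ Set.EqOn ψ' ψ ψ.source) ∧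
    (NInv.PEquivalent P A U B V ↔
      NInv.model I A U = NInv.model I B V ∧ ∃ ψ, NInv.IsMatching I A U B V ψ ∧ ψ ∈ P) := by
  obtain ⟨hAO, eA, heA, hUA, hvA⟩ := hA
  obtain ⟨hBO, eB, heB, hVB, hvB⟩ := hB
  subst hUA hVB
  have hinj : ∀ y ∈ eB.source, ∀ y' ∈ eB.source,
      (∀ i, NInv.value (I i) B y = NInv.value (I i) B y') → y = y' := fun y hy y' hy' h =>
    eB.injOn hy hy' (by ext i; rw [hvB y hy, hvB y' hy', h i])
  refine ⟨fun hmod => ?_, ?_, ?_⟩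
  -- The target of each chart is the projection of the model to its first `n` coordinates.
  · have htgt : eA.target = eB.target := by
      have h : ∀ p : NInv.E n, (p ∈ eA.target ↔ p ∈ eB.target) := fun p => by
        constructor
        · intro hp
          obtain ⟨y, hy, hxy⟩ := hmod.le ⟨eA.symm p, eA.map_target hp, rfl⟩
          have : eB y = p := by
            ext i
            rw [hvB y hy, ← eA.right_inv hp, hvA _ (eA.map_target hp)]
            exact congrFun (congrArg Prod.fst hxy) i
          exact this ▸ eB.map_source hy
        · intro hp
          obtain ⟨y, hy, hxy⟩ := hmod.ge ⟨eB.symm p, eB.map_target hp, rfl⟩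
          have : eA y = p := by
            ext i
            rw [hvA y hy, ← eB.right_inv hp, hvB _ (eB.map_target hp)]
            exact congrFun (congrArg Prod.fst hxy) i
          exact this ▸ eA.map_source hy
      exact Set.ext h
    have hmem : ∀ x ∈ eA.source, eA x ∈ eB.target := fun x hx => htgt ▸ eA.map_source hx
    have hmem' : ∀ x ∈ eB.source, eB x ∈ eA.target := fun x hx => htgt ▸ eB.map_source hx
    have hψ : NInv.IsMatching I A eA.source B eB.source (eA.trans eB.symm) := by
      refine ⟨?_, ?_, ?_, ?_, fun x hx i => ?_⟩
      · rw [OpenPartialHomeomorph.trans_source]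
        exact Set.inter_eq_left.2 hmem
      · rw [OpenPartialHomeomorph.trans_target]
        exact Set.inter_eq_left.2 hmem'
      · exact (contMDiffOn_symm_of_mem_maximalAtlas heB).comp
          (contMDiffOn_of_mem_maximalAtlas heA) hmem
      · exact (contMDiffOn_symm_of_mem_maximalAtlas heA).comp
          (contMDiffOn_of_mem_maximalAtlas heB) hmem'
      · rw [← hvA x hx, OpenPartialHomeomorph.coe_trans, Function.comp_apply,
          ← hvB _ (eB.map_target (hmem x hx))]
        exact congrArg (fun p : NInv.E n => p i) (eB.right_inv (hmem x hx))
    refine ⟨_, hψ, fun ψ' hψ' => ⟨hψ'.source_eq.trans hψ.source_eq.symm, fun x hx => ?_⟩⟩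
    have hx' : x ∈ eA.source := hψ.source_eq ▸ hx
    refine hinj _ (hψ'.target_eq ▸ ψ'.map_source (hψ'.source_eq.symm ▸ hx')) _
      (hψ.target_eq ▸ OpenPartialHomeomorph.map_source _ hx) fun i => ?_
    rw [hψ'.value_eq x hx', hψ.value_eq x hx']
  · rintro ⟨φ, hφP, hφU, hφV, hφ⟩
    have hmaps : ∀ x ∈ eA.source, φ x ∈ eB.source := fun x hx =>
      hφV ▸ φ.map_source (hφU.symm ▸ hx)
    have hval : ∀ x ∈ eA.source, ∀ i, NInv.value (I i) B (φ x) = NInv.value (I i) A x :=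
      fun x hx i => hinv i φ hφP _ (hOD (hAO x hx)) _ (hOD (hBO _ (hmaps x hx)))
        ⟨A, B, x, hφU.symm ▸ hx, rfl, rfl,
          (eA.open_source.eventually_mem hx).mono fun y hy => hφ y hy⟩
    have hmodel : ∀ x ∈ eA.source, NInv.modelMap I A x = NInv.modelMap I B (φ x) := by
      refine fun x hx => Prod.ext (funext fun i => (hval x hx i).symm) (funext fun α => ?_)
      -- `PushesAt` only tests functions that are smooth at the point.
      have hs : NInv.SmoothAt n (fun z => NInv.monom α.1 fun i => NInv.value (I i) B z) (φ x) :=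
        (NInv.smoothAt_congr (NInv.eventuallyEq_monom_value hvB α.1 (hmaps x hx))).2
          (NInv.smoothAt_comp_chart (NInv.contDiff_monom α.1) heB (hmaps x hx))
      change (_ : ℝ) * _ = _ * _
      rw [← hφ x hx _ hs]
      refine congrArg _ (A.congr ?_)
      filter_upwards [eA.open_source.mem_nhds hx] with z hz
      simp only [Function.comp_apply, hval z hz]
    refine ⟨?_, φ, ⟨hφU, hφV, hφU ▸ hP φ hφP, hφV ▸ hP φ.symm (P.symm hφP), hval⟩, hφP⟩
    have himg : φ '' eA.source = eB.source := by rw [← hφU, ← hφV, φ.image_source_eq_target]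
    rw [NInv.model, NInv.model, ← himg, Set.image_image]
    exact Set.image_congr hmodel
  · rintro ⟨hmod, ψ, hψ, hψP⟩
    refine ⟨ψ, hψP, hψ.source_eq, hψ.target_eq, fun x hx f hf => ?_⟩
    have hxV : ∀ z ∈ eA.source, ψ z ∈ eB.source := fun z hz =>
      hψ.target_eq ▸ ψ.map_source (hψ.source_eq.symm ▸ hz)
    have hcoord : ∀ z ∈ eA.source, eA z = eB (ψ z) := fun z hz => by
      ext i
      rw [hvA z hz, hvB _ (hxV z hz), hψ.value_eq z hz]
    -- Equality of the images gives some `y` with the same model point as `x`; the first `n`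
    -- coordinates force `y = ψ x`, so the remaining ones can be compared there.
    obtain ⟨y, hy, hyx⟩ := hmod.le ⟨x, hx, rfl⟩
    obtain rfl : y = ψ x := hinj y hy _ (hxV x hx) fun i => by
      rw [hψ.value_eq x hx]
      exact congrFun (congrArg Prod.fst hyx) i
    have hmon : ∀ α ∈ NInv.multiIdx n k, A (fun z => NInv.monom α fun i => eA z i) x =
        B (fun z => NInv.monom α fun i => eB z i) (ψ x) := fun α hα => by
      rw [← A.congr (NInv.eventuallyEq_monom_value hvA α hx),
        ← B.congr (NInv.eventuallyEq_monom_value hvB α hy)]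
      exact (mul_left_cancel₀ (inv_ne_zero (NInv.multiFactorial_ne_zero α))
        (congrFun (congrArg Prod.snd hyx) ⟨α, hα⟩)).symm
    have hψx : ContMDiffAt (𝓡 n) (𝓡 n) ∞ ψ x :=
      hψ.smooth.contMDiffAt (eA.open_source.mem_nhds hx)
    -- In the charts `eA` and `eB` the map `ψ` is the identity.
    have hgerm : (f ∘ ψ) ∘ eA.symm =ᶠ[𝓝 (eA x)] f ∘ eB.symm := by
      filter_upwards [eA.open_target.mem_nhds (eA.map_source hx)] with p hp
      have hz := eA.map_target hp
      have h : eB.symm p = ψ (eA.symm p) := by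
        rw [← eB.left_inv (hxV _ hz), ← hcoord _ hz, eA.right_inv hp]
      simp only [Function.comp_apply, h]
    rw [A.local_form eA heA x hx _ (ContMDiffAt.comp x hf hψx),
      B.local_form eB heB (ψ x) hy f hf]
    refine Finset.sum_congr rfl fun α hα => ?_
    rw [NInv.opCoeff_eq_of_apply_monom_eq A B heA heB hx hy (hcoord x hx) hmon hα,
      ((NInv.isLocalLinearAt_multiDeriv α _).congr hgerm).eq_of_nhds, hcoord x hx]
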